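/- For positive integers $b, a$ call $b$ a unitary divisor of $a$ if $b \mid a$ and $\gcd(b, a/b) = 1$. For an integer $n > 1$ with prime factorization $n = p_1^{a_1} \cdots p_r^{a_r}$ (distinct primes $p_i$, exponents $a_i \ge 1$), call $d$ an exponential unitary divisor (e-unitary divisor) of $n$ if $d = p_1^{b_1} \cdots p_r^{b_r}$, where $b_i$ is a unitary divisor of $a_i$ for every $i \in \{1, \dots, r\}$; by convention, $1$ is the only e-unitary divisor of $1$. Let $\sigma^{(e)*}(n)$ denote the sum of the e-unitary divisors of $n$. Then $$\limsup_{n \to \infty} \frac{\sigma^{(e)*}(n)}{n \log\log n} = \frac{6}{\pi^2}\, e^{\gamma},$$ where $\gamma$ is Euler's constant. -/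

import Mathlib

/-- `d` is a unitary divisor of `n`: `d ∣ n` and `gcd(d, n / d) = 1` (used for positive `n`). -/
def IsUnitaryDivisor (d n : ℕ) : Prop :=
  d ∣ n ∧ Nat.Coprime d (n / d)

/-- `d` is an exponential unitary divisor of the positive integer `n = ∏ p ^ a_p`:
`d = ∏ p ^ b_p` over the primes `p ∣ n`, where each `b_p` is a unitary divisor of the exponent
`a_p` of `p` in `n`. For `n = 1` the products are empty, so that `d = 1`. -/
def IsExpUnitaryDivisor (d n : ℕ) : Prop :=
  n ≠ 0 ∧ ∃ b : ℕ → ℕ,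
    (∀ p ∈ n.primeFactors, IsUnitaryDivisor (b p) (n.factorization p)) ∧
      d = ∏ p ∈ n.primeFactors, p ^ b p

theorem IsExpUnitaryDivisor.dvd {d n : ℕ} (h : IsExpUnitaryDivisor d n) : d ∣ n := by
  obtain ⟨hn, b, hb, rfl⟩ := h
  conv_rhs => rw [← Nat.prod_factorization_pow_eq_self hn]
  refine Finset.prod_dvd_prod_of_dvd _ _ fun p hp => pow_dvd_pow p ?_
  have hpos : 0 < n.factorization p :=
    (Nat.prime_of_mem_primeFactors hp).factorization_pos_of_dvd hn
      (Nat.dvd_of_mem_primeFactors hp)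
  exact Nat.le_of_dvd hpos (hb p hp).1

open Classical in
/-- The finite set of exponential unitary divisors of `n`. -/
noncomputable def expUnitaryDivisors (n : ℕ) : Finset ℕ :=
  n.divisors.filter fun d => IsExpUnitaryDivisor d n

theorem mem_expUnitaryDivisors {d n : ℕ} :
    d ∈ expUnitaryDivisors n ↔ IsExpUnitaryDivisor d n := by
  simp only [expUnitaryDivisors, Finset.mem_filter, Nat.mem_divisors]
  exact ⟨fun h => h.2, fun h => ⟨⟨h.dvd, h.1⟩, h⟩⟩

/-- The sum of the exponential unitary divisors of `n`. -/
noncomputable def sigmaExpUnitary (n : ℕ) : ℕ :=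
  ∑ d ∈ expUnitaryDivisors n, d

/-! Proper divisors of an exponent `a` are at most `a / 2`, so the local factor of `σ(n) / n` at `p`
is at most `1 + 1/p`, with equality at `a = 2`. Hence `σ(n) / n ≤ ∏_{p ∣ n} (1 + 1/p)`, and squares
of squarefree numbers attain this bound. Prime divisors of `n` beyond `log n` contribute a factor
tending to 1, and squared primorials contain all primes up to about `log n`. Both inequalities thus
reduce to `∏_{p ≤ x} (1 + 1/p) ~ (6/π²) e^γ log x`, which is Mertens' third theorem combined with
`ζ(2) = π²/6`.

For Mertens' theorem, `∑ 1/p` is compared with weights `1/k` placed at `2^k` (`primeCompensated`).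
These weights sum to a harmonic number, through which `γ` enters; their log-weighted sum is `log n +
O(1)`, as in Mertens' first theorem; and their Dirichlet series is the explicit `-log (1 - 2^(-t))`.
The first theorem and Dirichlet's test make the compensated series converge. Its value then follows
by Abel summation from the pole of `ζ` at 1, with no Tauberian argument. -/

open Filter Topology

/-! ### Bounds for the sum of the exponential unitary divisors -/

theorem sum_prime_pow_unitary_divisors_le {p a : ℕ} (hp : p.Prime) (ha : a ≠ 0) (s : Finset ℕ)
    (hs : ∀ b ∈ s, IsUnitaryDivisor b a) :
    ((∑ b ∈ s, p ^ b : ℕ) : ℝ) ≤ (p : ℝ) ^ a * (1 + 1 / p) := by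
  have hp0 : (0 : ℝ) < p := by exact_mod_cast hp.pos
  obtain ⟨k, rfl⟩ := Nat.exists_eq_succ_of_ne_zero ha
  have hle : ∀ b ∈ s.erase (k + 1), b < k + 1 := fun b hb =>
    lt_of_le_of_ne (Nat.le_of_dvd (Nat.succ_pos k) (hs b (Finset.mem_of_mem_erase hb)).1)
      (Finset.ne_of_mem_erase hb)
  have hmain : ∑ b ∈ s.erase (k + 1), p ^ b ≤ p ^ k := by
    rcases (Finset.eq_empty_or_nonempty (s.erase (k + 1))) with h0 | hne
    · simp [h0]
    -- Exponent 2 is the extremal case: its divisor 1 equals `k`, so the strict geometric bound,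
    -- which needs all exponents below `k`, does not apply.
    by_cases hk : k = 1
    · subst hk
      have hsub : s.erase (1 + 1) ⊆ {1} := by
        intro b hb
        have h1 := hle b hb
        have h2 : b ≠ 0 := fun h => by
          have := (hs b (Finset.mem_of_mem_erase hb)).1
          simp [h] at this
        simp; omega
      exact (Finset.sum_le_sum_of_subset hsub).trans (by simp)
    · refine (Nat.geomSum_lt hp.two_le fun b hb => ?_).le
      obtain ⟨c, hc⟩ := (hs b (Finset.mem_of_mem_erase hb)).1
      have h1 := hle b hb
      have hc2 : 2 ≤ c := by
        rcases c with _ | _ | c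
        · simp at hc
        · simp at hc; omega
        · omega
      have hb0 : b ≠ 0 := by rintro rfl; simp at hc
      have : b * 2 ≤ b * c := Nat.mul_le_mul_left b hc2
      omega
  have hsum : ∑ b ∈ s, p ^ b ≤ p ^ (k + 1) + p ^ k := by
    by_cases hk : k + 1 ∈ s
    · rw [← Finset.add_sum_erase _ _ hk]; omega
    · rw [Finset.erase_eq_of_notMem hk] at hmain; omega
  calc ((∑ b ∈ s, p ^ b : ℕ) : ℝ) ≤ ((p ^ (k + 1) + p ^ k : ℕ) : ℝ) := by exact_mod_cast hsum
    _ = _ := by push_cast; field_simp; ring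

theorem sigmaExpUnitary_le {n : ℕ} (hn : n ≠ 0) :
    (sigmaExpUnitary n : ℝ) ≤ n * ∏ p ∈ n.primeFactors, (1 + 1 / (p : ℝ)) := by
  classical
  set U : ℕ → Finset ℕ := fun p =>
    (n.factorization p).divisors.filter fun b => IsUnitaryDivisor b (n.factorization p) with hU
  set Φ : (∀ p ∈ n.primeFactors, ℕ) → ℕ := fun b =>
    ∏ x ∈ n.primeFactors.attach, x.1 ^ b x.1 x.2 with hΦ
  have hfac0 : ∀ p ∈ n.primeFactors, n.factorization p ≠ 0 := fun p hp =>
    ((Nat.prime_of_mem_primeFactors hp).factorization_pos_of_dvd hn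
      (Nat.dvd_of_mem_primeFactors hp)).ne'
  have hsub : expUnitaryDivisors n ⊆ (n.primeFactors.pi U).image Φ := by
    intro d hd
    obtain ⟨_, b, hb, rfl⟩ := mem_expUnitaryDivisors.1 hd
    refine Finset.mem_image.2 ⟨fun p _ => b p, Finset.mem_pi.2 fun p hp => ?_, ?_⟩
    · simp only [hU, Finset.mem_filter, Nat.mem_divisors]
      exact ⟨⟨(hb p hp).1, hfac0 p hp⟩, hb p hp⟩
    · exact Finset.prod_attach n.primeFactors fun p => p ^ b p
  have h1 : sigmaExpUnitary n ≤ ∏ p ∈ n.primeFactors, ∑ b ∈ U p, p ^ b := by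
    rw [Finset.prod_sum]
    refine (Finset.sum_le_sum_of_subset hsub).trans ?_
    -- Only an upper bound is needed, so unique factorization (injectivity of `Φ`) plays no role.
    exact Finset.sum_image_le_of_nonneg (f := fun d => d) fun _ _ => Nat.zero_le _
  calc (sigmaExpUnitary n : ℝ) ≤ ∏ p ∈ n.primeFactors, ((∑ b ∈ U p, p ^ b : ℕ) : ℝ) := by
        exact_mod_cast h1
    _ ≤ ∏ p ∈ n.primeFactors, ((p : ℝ) ^ n.factorization p * (1 + 1 / p)) := by
        refine Finset.prod_le_prod (fun _ _ => by positivity) fun p hp => ?_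
        exact sum_prime_pow_unitary_divisors_le (Nat.prime_of_mem_primeFactors hp) (hfac0 p hp) _
          fun b hb => (Finset.mem_filter.1 hb).2
    _ = _ := by
        rw [Finset.prod_mul_distrib]
        congr 1
        conv_rhs => rw [← Nat.prod_factorization_pow_eq_self hn]
        push_cast
        rfl

/-- All exponents of `q ^ 2` are 2, and both 1 and 2 are unitary divisors of 2; the primes of `e`
are those receiving exponent 2. -/
theorem isExpUnitaryDivisor_sq_of_squarefree {q e : ℕ} (hq : Squarefree q) (he : e ∣ q) :
    IsExpUnitaryDivisor (q * e) (q ^ 2) := by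
  have hq0 := hq.ne_zero
  have he0 : e ≠ 0 := ne_zero_of_dvd_ne_zero hq0 he
  refine ⟨pow_ne_zero 2 hq0, (q * e).factorization, fun p hp => ?_, ?_⟩
  · rw [Nat.primeFactors_pow q two_ne_zero] at hp
    have h1 : q.factorization p = 1 :=
      le_antisymm (hq.natFactorization_le_one p)
        ((Nat.prime_of_mem_primeFactors hp).factorization_pos_of_dvd hq0
          (Nat.dvd_of_mem_primeFactors hp))
    have h2 : e.factorization p ≤ 1 := (hq.squarefree_of_dvd he).natFactorization_le_one p
    rw [Nat.factorization_mul hq0 he0, Nat.factorization_pow, Finsupp.add_apply,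
      Finsupp.smul_apply, h1]
    unfold IsUnitaryDivisor
    interval_cases e.factorization p <;> decide
  · have h := Nat.prod_factorization_pow_eq_self (mul_ne_zero hq0 he0)
    rw [Finsupp.prod, Nat.support_factorization] at h
    conv_lhs => rw [← h]
    congr 1
    rw [Nat.primeFactors_pow q two_ne_zero, Nat.primeFactors_mul hq0 he0]
    exact Finset.union_eq_left.2 (Nat.primeFactors_mono he hq0)

theorem le_sigmaExpUnitary_sq_of_squarefree {q : ℕ} (hq : Squarefree q) :
    (q : ℝ) ^ 2 * ∏ p ∈ q.primeFactors, (1 + 1 / (p : ℝ)) ≤ sigmaExpUnitary (q ^ 2) := by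
  classical
  have hinj : Set.InjOn (fun e => q * e) (q.divisors : Set ℕ) := fun a _ b _ h =>
    Nat.eq_of_mul_eq_mul_left (Nat.pos_of_ne_zero hq.ne_zero) h
  have hsub : q.divisors.image (fun e => q * e) ⊆ expUnitaryDivisors (q ^ 2) := by
    intro d hd
    obtain ⟨e, he, rfl⟩ := Finset.mem_image.1 hd
    exact mem_expUnitaryDivisors.2
      (isExpUnitaryDivisor_sq_of_squarefree hq (Nat.dvd_of_mem_divisors he))
  have h1 : q * ∑ e ∈ q.divisors, e ≤ sigmaExpUnitary (q ^ 2) := by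
    refine le_trans (le_of_eq ?_) (Finset.sum_le_sum_of_subset hsub)
    rw [Finset.sum_image hinj, Finset.mul_sum]
  have h2 : ∏ p ∈ q.primeFactors, (1 + p) = ∑ e ∈ q.divisors, e := by
    simpa using (ArithmeticFunction.isMultiplicative_id
      ).prodPrimeFactors_one_add_of_squarefree hq
  have h3 : (q : ℝ) * ∏ p ∈ q.primeFactors, (1 + 1 / (p : ℝ)) =
      ((∏ p ∈ q.primeFactors, (1 + p) : ℕ) : ℝ) := by
    have hprod : (q : ℝ) = ∏ p ∈ q.primeFactors, (p : ℝ) := by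
      rw [← Nat.cast_prod, Nat.prod_primeFactors_of_squarefree hq]
    rw [hprod, ← Finset.prod_mul_distrib]
    push_cast
    refine Finset.prod_congr rfl fun p hp => ?_
    have : (p : ℝ) ≠ 0 := by exact_mod_cast (Nat.prime_of_mem_primeFactors hp).ne_zero
    field_simp
    ring
  rw [sq, mul_assoc, h3, h2]
  exact_mod_cast h1

/-! ### Mertens' first theorem -/

theorem log_factorial_eq_sum_primesLE (n : ℕ) :
    Real.log (n.factorial : ℝ) =
      ∑ p ∈ n.primesLE, (n.factorial.factorization p : ℝ) * Real.log p := by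
  have h := Nat.prod_factorization_pow_eq_self n.factorial_ne_zero
  rw [Finsupp.prod_of_support_subset (s := n.primesLE)] at h
  · conv_lhs => rw [← h]
    push_cast
    rw [Real.log_prod]
    · simp
    · intro p hp
      have := (Nat.prime_of_mem_primesLE hp).pos
      positivity
  · intro p hp
    rw [Nat.support_factorization, Nat.mem_primeFactors] at hp
    exact Nat.mem_primesLE.2 ⟨(hp.1.dvd_factorial).1 hp.2.1, hp.1⟩
  · simp

theorem div_sub_one_le_factorization_factorial {p : ℕ} (hp : p.Prime) (n : ℕ) :
    (n : ℝ) / p - 1 ≤ n.factorial.factorization p := by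
  have h : n / p ≤ n.factorial.factorization p := by
    -- The `+ 2` keeps the index 1 in the range of Legendre's sum even when `Nat.log p n = 0`.
    rw [Nat.factorization_factorial hp (b := Nat.log p n + 2) (by omega)]
    refine le_trans (by simp) (Finset.single_le_sum (f := fun i => n / p ^ i)
      (fun _ _ => Nat.zero_le _) (Finset.mem_Ico.2 ⟨le_refl 1, by omega⟩))
  have h2 : (n : ℝ) / p < (n / p : ℕ) + 1 := by
    rw [div_lt_iff₀ (by exact_mod_cast hp.pos)]
    exact_mod_cast Nat.lt_mul_of_div_lt (Nat.lt_succ_self (n / p)) hp.pos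
  have h3 : ((n / p : ℕ) : ℝ) ≤ n.factorial.factorization p := by exact_mod_cast h
  linarith

theorem factorization_factorial_le_div {p : ℕ} (hp : p.Prime) (n : ℕ) :
    (n.factorial.factorization p : ℝ) ≤ n / (p - 1) := by
  have h : (p - 1) * n.factorial.factorization p ≤ n := by
    rw [Nat.sub_one_mul_factorization_factorial hp]; exact Nat.sub_le _ _
  have hp1 : (1 : ℝ) < p := by exact_mod_cast hp.one_lt
  rw [le_div_iff₀ (by linarith), mul_comm]
  have : (((p - 1) * n.factorial.factorization p : ℕ) : ℝ) ≤ n := by exact_mod_cast h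
  rwa [Nat.cast_mul, Nat.cast_sub hp.one_le, Nat.cast_one] at this

/-- Comparison with `4 m^(-3/2)`, from `log m ≤ 2 √m` and `m - 1 ≥ m / 2`. -/
theorem summable_log_div_mul_sub_one :
    Summable fun m : ℕ => Real.log m / ((m : ℝ) * (m - 1)) := by
  have h : Summable fun m : ℕ => 4 * (m : ℝ) ^ (-(3 / 2) : ℝ) :=
    (Real.summable_nat_rpow.2 (by norm_num)).mul_left 4
  refine Summable.of_norm_bounded h fun m => ?_
  rcases Nat.lt_or_ge m 2 with hm | hm
  · interval_cases m <;> norm_num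
  have hm' : (2 : ℝ) ≤ m := by exact_mod_cast hm
  have hpos : (0 : ℝ) < m := by linarith
  have hlog : Real.log m ≤ 2 * (m : ℝ) ^ (1 / 2 : ℝ) := by
    have := Real.log_le_rpow_div hpos.le (show (0 : ℝ) < 1 / 2 by norm_num)
    linarith
  have hl0 : 0 ≤ Real.log m := Real.log_nonneg (by linarith)
  rw [Real.norm_of_nonneg (by apply div_nonneg hl0; nlinarith), div_le_iff₀ (by nlinarith)]
  have he : (m : ℝ) ^ (1 / 2 : ℝ) = (m : ℝ) ^ (-(3 / 2) : ℝ) * (m : ℝ) ^ 2 := by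
    rw [← Real.rpow_natCast, ← Real.rpow_add hpos]; norm_num
  have hq : 0 ≤ (m : ℝ) ^ (-(3 / 2) : ℝ) := by positivity
  rw [he] at hlog
  nlinarith [mul_nonneg hq (mul_nonneg hpos.le (sub_nonneg.2 hm'))]

/-- Both bounds come from `log n! = n log n + O(n)`. Replacing `v_p(n!)` by `n/p` costs at most
`θ(n) ≤ n log 4` on one side; on the other, `1/(p-1) = 1/p + 1/(p(p-1))` leaves a convergent series.
-/
theorem exists_abs_sum_log_div_prime_sub_log_le :
    ∃ C : ℝ, ∀ n : ℕ, n ≠ 0 →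
      |∑ p ∈ n.primesLE, Real.log p / p - Real.log n| ≤ C := by
  set T : ℝ := ∑' m : ℕ, Real.log m / ((m : ℝ) * (m - 1)) with hT
  have hterm : ∀ m : ℕ, 0 ≤ Real.log m / ((m : ℝ) * (m - 1)) := by
    intro m
    rcases Nat.eq_zero_or_pos m with rfl | hm
    · simp
    have : (1 : ℝ) ≤ m := by exact_mod_cast hm
    exact div_nonneg (Real.log_nonneg this) (mul_nonneg (by linarith) (by linarith))
  have hT0 : 0 ≤ T := tsum_nonneg hterm
  have h4 : 0 ≤ Real.log 4 := Real.log_nonneg (by norm_num)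
  refine ⟨1 + T + Real.log 4, fun n hn => ?_⟩
  have hn0 : (0 : ℝ) < n := by exact_mod_cast Nat.pos_of_ne_zero hn
  have hn1 : (1 : ℝ) ≤ n := by exact_mod_cast Nat.pos_of_ne_zero hn
  have hfac := log_factorial_eq_sum_primesLE n
  have hup : n * ∑ p ∈ n.primesLE, Real.log p / p - Real.log 4 * n ≤ n * Real.log n := by
    have h1 : n * ∑ p ∈ n.primesLE, Real.log p / p - ∑ p ∈ n.primesLE, Real.log p ≤
        Real.log n.factorial := by
      rw [hfac, Finset.mul_sum, ← Finset.sum_sub_distrib]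
      refine Finset.sum_le_sum fun p hp => ?_
      have hpp := Nat.prime_of_mem_primesLE hp
      have hl : 0 ≤ Real.log p := Real.log_nonneg (by exact_mod_cast hpp.one_le)
      have := mul_le_mul_of_nonneg_right (div_sub_one_le_factorization_factorial hpp n) hl
      calc _ = ((n : ℝ) / p - 1) * Real.log p := by ring
        _ ≤ _ := this
    have h2 : Real.log n.factorial ≤ n * Real.log n := by
      rw [← Real.log_pow]
      apply Real.log_le_log (by exact_mod_cast n.factorial_pos)
      exact_mod_cast n.factorial_le_pow
    have h3 := Chebyshev.theta_le_log4_mul_x hn0.le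
    rw [Chebyshev.theta_eq_sum_primesLE_log] at h3
    linarith
  have hlow : n * Real.log n - n ≤ n * ∑ p ∈ n.primesLE, Real.log p / p + n * T := by
    have h1 : n * Real.log n - n ≤ Real.log n.factorial := by
      have := Stirling.le_log_factorial_stirling hn
      have h5 : 0 ≤ Real.log n := Real.log_nonneg hn1
      have h6 : 0 ≤ Real.log (2 * Real.pi) :=
        Real.log_nonneg (by nlinarith [Real.pi_gt_three])
      linarith
    have h2 : Real.log n.factorial ≤ ∑ p ∈ n.primesLE,
        (n * (Real.log p / p) + n * (Real.log p / ((p : ℝ) * (p - 1)))) := by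
      rw [hfac]
      refine Finset.sum_le_sum fun p hp => ?_
      have hpp := Nat.prime_of_mem_primesLE hp
      have hp1 : (1 : ℝ) < p := by exact_mod_cast hpp.one_lt
      have hl : 0 ≤ Real.log p := Real.log_nonneg hp1.le
      refine (mul_le_mul_of_nonneg_right (factorization_factorial_le_div hpp n) hl).trans_eq ?_
      have : (p : ℝ) - 1 ≠ 0 := by linarith
      field_simp
      ring
    rw [Finset.sum_add_distrib, ← Finset.mul_sum, ← Finset.mul_sum] at h2
    have h3 := (summable_log_div_mul_sub_one).sum_le_tsum n.primesLE fun m _ => hterm m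
    have := mul_le_mul_of_nonneg_left h3 hn0.le
    linarith
  have hup' : ∑ p ∈ n.primesLE, Real.log p / p - Real.log 4 ≤ Real.log n :=
    le_of_mul_le_mul_left (by linarith) hn0
  have hlow' : Real.log n - 1 ≤ ∑ p ∈ n.primesLE, Real.log p / p + T :=
    le_of_mul_le_mul_left (by linarith) hn0
  rw [abs_le]
  constructor <;> linarith

/-! ### An Abelian theorem -/

/-- Toeplitz averaging: the total mass is 1 and escapes every finite set, so only values of `W` near
its limit count. -/
theorem tendsto_tsum_mul_of_regular_weights {ι : Type*} {l : Filter ι} {u : ι → ℕ → ℝ}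
    {W : ℕ → ℝ} {c : ℝ} (hW : Tendsto W atTop (𝓝 c)) (hu0 : ∀ᶠ i in l, ∀ m, 0 ≤ u i m)
    (hu1 : ∀ᶠ i in l, HasSum (u i) 1) (hul : ∀ m, Tendsto (fun i => u i m) l (𝓝 0)) :
    Tendsto (fun i => ∑' m, u i m * W m) l (𝓝 c) := by
  obtain ⟨B, hB⟩ : ∃ B, ∀ m, |W m - c| ≤ B := by
    have h : Tendsto (fun m => |W m - c|) atTop (𝓝 |c - c|) := (hW.sub_const c).abs
    obtain ⟨B, hB⟩ := h.bddAbove_range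
    exact ⟨B, fun m => hB ⟨m, rfl⟩⟩
  rw [Metric.tendsto_nhds]
  intro ε hε
  obtain ⟨M, hM⟩ := Metric.tendsto_atTop.1 hW (ε / 2) (half_pos hε)
  have hfin : Tendsto (fun i => B * ∑ m ∈ Finset.range M, u i m) l (𝓝 0) := by
    simpa using (tendsto_finsetSum (Finset.range M) fun m _ => hul m).const_mul B
  filter_upwards [hu0, hu1, hfin.eventually (gt_mem_nhds (half_pos hε))] with i h0 h1 h2
  have hs : Summable fun m => u i m * (W m - c) :=
    Summable.of_norm_bounded (h1.summable.mul_left B) fun m => by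
      rw [norm_mul, Real.norm_of_nonneg (h0 m), mul_comm]
      exact mul_le_mul_of_nonneg_right (hB m) (h0 m)
  have heq : ∑' m, u i m * W m = ∑' m, u i m * (W m - c) + c := by
    have := (hs.hasSum.add (h1.mul_right c)).tsum_eq
    rw [one_mul] at this
    rw [← this]
    exact tsum_congr fun m => by ring
  rw [heq, Real.dist_eq, add_sub_cancel_right]
  have hbound : ∀ m, ‖u i m * (W m - c)‖ ≤
      (if m ∈ Finset.range M then B * u i m else 0) + ε / 2 * u i m := by
    intro m
    rw [norm_mul, Real.norm_of_nonneg (h0 m)]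
    split_ifs with hm
    · have := mul_le_mul_of_nonneg_left (hB m) (h0 m)
      have h3 : 0 ≤ ε / 2 * u i m := mul_nonneg (half_pos hε).le (h0 m)
      rw [Real.norm_eq_abs]
      linarith
    · have h4 := hM m (by simpa using hm)
      rw [Real.dist_eq] at h4
      have := mul_le_mul_of_nonneg_left h4.le (h0 m)
      rw [Real.norm_eq_abs]
      linarith
  have hg : HasSum (fun m => (if m ∈ Finset.range M then B * u i m else 0) + ε / 2 * u i m)
      (B * ∑ m ∈ Finset.range M, u i m + ε / 2) := by
    have ha : HasSum (fun m => if m ∈ Finset.range M then B * u i m else 0)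
        (B * ∑ m ∈ Finset.range M, u i m) := by
      have := hasSum_sum_of_ne_finset_zero (L := .unconditional ℕ) (s := Finset.range M)
        (f := fun m => if m ∈ Finset.range M then B * u i m else 0)
        (fun m hm => if_neg hm)
      rwa [Finset.sum_congr rfl fun m hm => if_pos hm, ← Finset.mul_sum] at this
    simpa using ha.add (h1.mul_left (ε / 2))
  have := tsum_of_norm_bounded hg hbound
  rw [Real.norm_eq_abs] at this
  linarith

/-- Abel summation against weights `φ` that decrease to `0`: the values of a convergent series
regularised by `φ i` tend to its sum when `φ i` tends to `1` pointwise. -/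
theorem tendsto_tsum_mul_of_tendsto_sum {ι : Type*} {l : Filter ι} {φ : ι → ℕ → ℝ}
    {w : ℕ → ℝ} {c : ℝ} (hw : Tendsto (fun n => ∑ m ∈ Finset.range n, w m) atTop (𝓝 c))
    (hanti : ∀ᶠ i in l, Antitone (φ i)) (hzero : ∀ᶠ i in l, Tendsto (φ i) atTop (𝓝 0))
    (hone : ∀ᶠ i in l, φ i 0 = 1) (hlim : ∀ m, Tendsto (fun i => φ i m) l (𝓝 1))
    (hsum : ∀ᶠ i in l, Summable fun m => φ i m * w m) :
    Tendsto (fun i => ∑' m, φ i m * w m) l (𝓝 c) := by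
  set W : ℕ → ℝ := fun n => ∑ m ∈ Finset.range (n + 1), w m with hWdef
  have hW : Tendsto W atTop (𝓝 c) := hw.comp (tendsto_add_atTop_nat 1)
  -- After summation by parts the partial sums of `w` are averaged against the differences of `φ i`,
  -- whose total telescopes to 1.
  have hu1 : ∀ᶠ i in l, HasSum (fun m => φ i m - φ i (m + 1)) 1 := by
    filter_upwards [hanti, hzero, hone] with i h1 h2 h3
    rw [hasSum_iff_tendsto_nat_of_nonneg fun m => sub_nonneg.2 (h1 (Nat.le_succ m))]
    simp_rw [Finset.sum_range_sub', h3]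
    simpa using h2.const_sub 1
  have hu0 : ∀ᶠ i in l, ∀ m, 0 ≤ φ i m - φ i (m + 1) := by
    filter_upwards [hanti] with i h1 m using sub_nonneg.2 (h1 (Nat.le_succ m))
  have key := tendsto_tsum_mul_of_regular_weights hW hu0 hu1
    fun m => by simpa using (hlim m).sub (hlim (m + 1))
  refine key.congr' ?_
  filter_upwards [hu0, hu1, hzero, hsum] with i h0 h1 h2 h3
  obtain ⟨B, hB⟩ := hW.abs.bddAbove_range
  have hs : Summable fun m => (φ i m - φ i (m + 1)) * W m :=
    Summable.of_norm_bounded (h1.summable.mul_left B) fun m => by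
      rw [norm_mul, Real.norm_of_nonneg (h0 m), mul_comm, Real.norm_eq_abs]
      exact mul_le_mul_of_nonneg_right (hB ⟨m, rfl⟩) (h0 m)
  have hparts : ∀ n, ∑ m ∈ Finset.range (n + 1), φ i m * w m =
      ∑ m ∈ Finset.range n, (φ i m - φ i (m + 1)) * W m + φ i n * W n := by
    intro n
    induction n with
    | zero => simp [hWdef]
    | succ n ih =>
      rw [Finset.sum_range_succ, ih, Finset.sum_range_succ]
      simp only [hWdef, Finset.sum_range_succ _ (n + 1)]
      ring
  have hl := (h3.hasSum.tendsto_sum_nat).comp (tendsto_add_atTop_nat 1)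
  have hr := hs.hasSum.tendsto_sum_nat.add (h2.mul hW)
  rw [zero_mul, add_zero] at hr
  exact tendsto_nhds_unique (hr.congr fun n => (hparts n).symm) hl

/-! ### Mertens' third theorem -/

theorem sum_range_ite_prime (F : ℕ → ℝ) (n : ℕ) :
    ∑ m ∈ Finset.range n, (if (m + 1).Prime then F (m + 1) else 0) = ∑ p ∈ n.primesLE, F p := by
  rw [Nat.primesLE_eq_filter_range, Finset.sum_filter, Finset.sum_range_succ']
  simp [Nat.not_prime_zero]

/-- `Nat.log 2` jumps exactly at powers of two. The right side contains `g 0` even for `n = 0`,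
hence the condition on `g 0`. -/
theorem sum_range_ite_two_pow {g : ℕ → ℝ} (hg : g 0 = 0) (n : ℕ) :
    ∑ m ∈ Finset.range n,
        (if 2 ^ Nat.log 2 (m + 1) = m + 1 then g (Nat.log 2 (m + 1)) else 0) =
      ∑ k ∈ Finset.range (Nat.log 2 n + 1), g k := by
  induction n with
  | zero => simp [hg]
  | succ n ih =>
    rw [Finset.sum_range_succ, ih]
    rcases Nat.eq_zero_or_pos n with rfl | hn
    · simp [hg]
    split_ifs with h
    · have hk : Nat.log 2 (n + 1) = Nat.log 2 n + 1 := by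
        obtain ⟨k, hk⟩ : ∃ k, Nat.log 2 (n + 1) = k + 1 :=
          Nat.exists_eq_succ_of_ne_zero fun h0 => by rw [h0] at h; omega
        rw [hk] at h ⊢
        have h2 : Nat.log 2 n = k := by
          apply Nat.log_eq_of_pow_le_of_lt_pow <;> (rw [pow_succ] at *; omega)
        rw [h2]
      rw [hk, Finset.sum_range_succ _ (Nat.log 2 n + 1)]
    · have hle : Nat.log 2 (n + 1) ≤ Nat.log 2 n := by
        apply Nat.le_log_of_pow_le (by norm_num)
        have : 2 ^ Nat.log 2 (n + 1) ≤ n + 1 := Nat.pow_log_le_self 2 n.succ_ne_zero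
        omega
      have hk := le_antisymm hle (Nat.log_mono_right (Nat.le_succ n))
      rw [hk, add_zero]

/-- The reciprocals of the primes, compensated by the weights `1 / k` at `2 ^ k`; the index is
shifted by one. -/
noncomputable def primeCompensated (m : ℕ) : ℝ :=
  (if (m + 1).Prime then 1 / ((m + 1 : ℕ) : ℝ) else 0) -
    if 2 ^ Nat.log 2 (m + 1) = m + 1 then 1 / (Nat.log 2 (m + 1) : ℝ) else 0

theorem sum_primeCompensated (n : ℕ) :
    ∑ m ∈ Finset.range n, primeCompensated m =
      ∑ p ∈ n.primesLE, 1 / (p : ℝ) - harmonic (Nat.log 2 n) := by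
  unfold primeCompensated
  rw [Finset.sum_sub_distrib, sum_range_ite_prime (fun p => 1 / (p : ℝ)),
    sum_range_ite_two_pow (g := fun k => 1 / (k : ℝ)) (by simp), Finset.sum_range_succ']
  simp [harmonic]

theorem mul_log_two_le_log {n : ℕ} (hn : n ≠ 0) :
    (Nat.log 2 n : ℝ) * Real.log 2 ≤ Real.log n := by
  rw [← Real.log_pow]
  exact Real.log_le_log (by positivity) (by exact_mod_cast Nat.pow_log_le_self 2 hn)

theorem log_le_add_one_mul_log_two {n : ℕ} (hn : n ≠ 0) :
    Real.log n ≤ ((Nat.log 2 n : ℝ) + 1) * Real.log 2 := by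
  have h : (n : ℝ) ≤ 2 ^ (Nat.log 2 n + 1) := by
    exact_mod_cast (Nat.lt_pow_succ_log_self (by norm_num) n).le
  have h2 := Real.log_le_log (by exact_mod_cast Nat.pos_of_ne_zero hn) h
  rw [Real.log_pow] at h2
  exact_mod_cast h2

/-- A prime contributes `log p / p` and a power `2^k` with `k ≥ 1` contributes `log 2`; both totals
are `log n + O(1)`. -/
theorem abs_sum_primeCompensated_mul_log_le :
    ∃ C : ℝ, ∀ n : ℕ,
      ‖∑ m ∈ Finset.range n, primeCompensated m * Real.log ((m + 1 : ℕ) : ℝ)‖ ≤ C := by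
  obtain ⟨C, hC⟩ := exists_abs_sum_log_div_prime_sub_log_le
  refine ⟨C + Real.log 2, fun n => ?_⟩
  have h2 : 0 ≤ Real.log 2 := Real.log_nonneg (by norm_num)
  rcases eq_or_ne n 0 with rfl | hn
  · have := (abs_nonneg _).trans (hC 1 one_ne_zero)
    simpa using add_nonneg this h2
  have hsum : ∑ m ∈ Finset.range n, primeCompensated m * Real.log ((m + 1 : ℕ) : ℝ) =
      ∑ p ∈ n.primesLE, Real.log p / p - Nat.log 2 n * Real.log 2 := by
    have h1 : ∀ m, primeCompensated m * Real.log ((m + 1 : ℕ) : ℝ) =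
        (if (m + 1).Prime then Real.log ((m + 1 : ℕ) : ℝ) / ((m + 1 : ℕ) : ℝ) else 0) -
          if 2 ^ Nat.log 2 (m + 1) = m + 1 then
            (if Nat.log 2 (m + 1) = 0 then 0 else Real.log 2) else 0 := by
      intro m
      rw [primeCompensated, sub_mul, ite_mul, ite_mul, zero_mul]
      congr 1
      · congr 1; ring
      · split_ifs with h h0
        · simp [h0]
        · rw [← h, Nat.log_pow (by norm_num), Nat.cast_pow, Real.log_pow]
          have : (Nat.log 2 (m + 1) : ℝ) ≠ 0 := by exact_mod_cast h0
          field_simp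
          simp
        · rfl
    rw [Finset.sum_congr rfl fun m _ => h1 m, Finset.sum_sub_distrib,
      sum_range_ite_prime (fun p => Real.log p / (p : ℝ)),
      sum_range_ite_two_pow (g := fun k => if k = 0 then 0 else Real.log 2) (by simp),
      Finset.sum_range_succ']
    simp
  have h3 := hC n hn
  have h4 := mul_log_two_le_log hn
  have h5 := log_le_add_one_mul_log_two hn
  rw [hsum, Real.norm_eq_abs]
  rw [abs_le] at h3 ⊢
  constructor <;> linarith

theorem exists_tendsto_sum_primeCompensated :
    ∃ c : ℝ, Tendsto (fun n => ∑ m ∈ Finset.range n, primeCompensated m) atTop (𝓝 c) := by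
  obtain ⟨C, hC⟩ := abs_sum_primeCompensated_mul_log_le
  -- Dirichlet's test with weights `1 / log (m + 1)`; the maximum avoids `log 1 = 0` at `m = 0`,
  -- where the coefficient vanishes anyway.
  set f : ℕ → ℝ := fun m => (Real.log ((max (m + 1) 2 : ℕ) : ℝ))⁻¹ with hf
  have hpos : ∀ m : ℕ, 0 < Real.log ((max (m + 1) 2 : ℕ) : ℝ) := fun m =>
    Real.log_pos (by exact_mod_cast lt_of_lt_of_le one_lt_two (le_max_right (m + 1) 2))
  have hanti : Antitone f := fun a b hab => by
    refine inv_anti₀ (hpos a) (Real.log_le_log ?_ ?_)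
    · exact_mod_cast lt_of_lt_of_le two_pos (le_max_right (a + 1) 2)
    · exact_mod_cast max_le_max (by omega) le_rfl
  have hlim : Tendsto f atTop (𝓝 0) := by
    refine tendsto_inv_atTop_zero.comp (Real.tendsto_log_atTop.comp ?_)
    refine tendsto_natCast_atTop_atTop.comp (tendsto_atTop_mono (fun m => ?_) tendsto_id)
    exact (Nat.le_succ m).trans (le_max_left _ _)
  have h := hanti.cauchySeq_series_mul_of_tendsto_zero_of_bounded hlim hC
  obtain ⟨c, hc⟩ := cauchySeq_tendsto_of_complete h
  refine ⟨c, hc.congr fun n => Finset.sum_congr rfl fun m _ => ?_⟩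
  rcases Nat.eq_zero_or_pos m with rfl | hm
  · simp [primeCompensated, Nat.not_prime_one]
  · have h1 : max (m + 1) 2 = m + 1 := max_eq_left (by omega)
    have h2 := (hpos m).ne'
    rw [h1] at h2
    simp only [hf, h1, smul_eq_mul]
    field_simp

theorem hasSum_rpow_mul_primeCompensated {t : ℝ} (ht : 0 < t) :
    HasSum (fun m : ℕ => ((m + 1 : ℕ) : ℝ) ^ (-t) * primeCompensated m)
      (∑' p : Nat.Primes, (p : ℝ) ^ (-(1 + t)) + Real.log (1 - 2 ^ (-t))) := by
  have hprimes : HasSum (fun m : ℕ => ((m + 1 : ℕ) : ℝ) ^ (-t) *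
      (if (m + 1).Prime then 1 / ((m + 1 : ℕ) : ℝ) else 0))
      (∑' p : Nat.Primes, (p : ℝ) ^ (-(1 + t))) := by
    have hs : Summable fun p : Nat.Primes => (p : ℝ) ^ (-(1 + t)) :=
      Nat.Primes.summable_rpow.2 (by linarith)
    have hinj : Function.Injective fun p : Nat.Primes => (p : ℕ) - 1 := fun p q h => by
      have hp := p.2.one_lt
      have hq := q.2.one_lt
      exact Subtype.ext (by simp only at h; omega)
    rw [← hinj.hasSum_iff]
    · convert hs.hasSum using 2 with p
      have hp := p.2
      have hp1 : (p : ℕ) - 1 + 1 = p := Nat.sub_add_cancel hp.one_le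
      have hp0 : (0 : ℝ) < (p : ℕ) := by exact_mod_cast hp.pos
      simp only [Function.comp, hp1, if_pos hp]
      rw [neg_add, add_comm, Real.rpow_add hp0, Real.rpow_neg_one, one_div]
    · intro m hm
      rw [if_neg, mul_zero]
      exact fun h => hm ⟨⟨m + 1, h⟩, by simp⟩
  have hpows : HasSum (fun m : ℕ => ((m + 1 : ℕ) : ℝ) ^ (-t) *
      (if 2 ^ Nat.log 2 (m + 1) = m + 1 then 1 / (Nat.log 2 (m + 1) : ℝ) else 0))
      (-Real.log (1 - 2 ^ (-t))) := by
    have hx : |(2 : ℝ) ^ (-t)| < 1 := by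
      rw [abs_of_pos (by positivity)]
      exact Real.rpow_lt_one_of_one_lt_of_neg (by norm_num) (by linarith)
    -- The power `2^0` is left out: its weight is `1 / 0 = 0`.
    have hinj : Function.Injective fun k : ℕ => 2 ^ (k + 1) - 1 := fun k l h => by
      have h1 := Nat.one_le_two_pow (n := k + 1)
      have h2 := Nat.one_le_two_pow (n := l + 1)
      have h3 : 2 ^ (k + 1) = 2 ^ (l + 1) := by simp only at h; omega
      have := Nat.pow_right_injective le_rfl h3
      omega
    rw [← hinj.hasSum_iff]
    · convert Real.hasSum_pow_div_log_of_abs_lt_one hx using 2 with k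
      have h1 : 2 ^ (k + 1) - 1 + 1 = 2 ^ (k + 1) := Nat.sub_add_cancel Nat.one_le_two_pow
      simp only [Function.comp, h1, Nat.log_pow one_lt_two, if_true]
      push_cast
      rw [← Real.rpow_natCast, ← Real.rpow_natCast, ← Real.rpow_mul (by norm_num),
        ← Real.rpow_mul (by norm_num), mul_one_div, mul_comm]
    · intro m hm
      split_ifs with h
      · rcases hk : Nat.log 2 (m + 1) with _ | k
        · simp
        · rw [hk] at h
          exact absurd ⟨k, by simp [h]⟩ hm
      · simp
  rw [← sub_neg_eq_add]
  simp only [primeCompensated, mul_sub]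
  exact hprimes.sub hpows

/-! ### The sum of `p^(-s)` over primes near `s = 1` -/

/-- The difference between the local factor of `log ζ` and its leading term. -/
noncomputable def negLogOneSubSubSelf (y : ℝ) : ℝ := -Real.log (1 - y) - y

theorem abs_negLogOneSubSubSelf_le {y : ℝ} (h0 : 0 ≤ y) (h1 : y ≤ 1 / 2) :
    ‖negLogOneSubSubSelf y‖ ≤ 2 * y ^ 2 := by
  have h := Real.abs_log_sub_add_sum_range_le (x := y) (by rw [abs_of_nonneg h0]; linarith) 1
  simp only [Finset.sum_range_one, Nat.cast_zero, zero_add, pow_one, div_one,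
    abs_of_nonneg h0] at h
  rw [negLogOneSubSubSelf, Real.norm_eq_abs, ← abs_neg]
  calc _ = |y + Real.log (1 - y)| := by congr 1; ring
    _ ≤ _ := h
    _ ≤ _ := by
      rw [div_le_iff₀ (by linarith)]
      norm_num
      nlinarith [sq_nonneg y]

theorem prime_rpow_neg_le {s : ℝ} (hs : 1 ≤ s) {p : ℕ} (hp : p.Prime) :
    (p : ℝ) ^ (-s) ≤ (p : ℝ)⁻¹ := by
  rw [← Real.rpow_neg_one]
  exact Real.rpow_le_rpow_of_exponent_le (by exact_mod_cast hp.one_le) (by linarith)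

theorem prime_inv_le_half {p : ℕ} (hp : p.Prime) : (p : ℝ)⁻¹ ≤ 1 / 2 := by
  rw [one_div]
  exact inv_anti₀ two_pos (by exact_mod_cast hp.two_le)

theorem summable_primes_inv_sq : Summable fun p : Nat.Primes => 2 * (((p : ℕ) : ℝ)⁻¹) ^ 2 := by
  refine Summable.mul_left 2 ?_
  have h : Summable fun p : Nat.Primes => ((p : ℕ) : ℝ) ^ (-2 : ℝ) :=
    Nat.Primes.summable_rpow.2 (by norm_num)
  refine h.congr fun p => ?_
  rw [Real.rpow_neg (by positivity), inv_pow]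
  norm_cast

theorem norm_negLogOneSubSubSelf_prime_rpow_le {s : ℝ} (hs : 1 ≤ s) {p : ℕ} (hp : p.Prime) :
    ‖negLogOneSubSubSelf ((p : ℝ) ^ (-s))‖ ≤ 2 * ((p : ℝ)⁻¹) ^ 2 := by
  have h1 := prime_rpow_neg_le hs hp
  have h0 : 0 ≤ (p : ℝ) ^ (-s) := by positivity
  refine (abs_negLogOneSubSubSelf_le h0 (h1.trans (prime_inv_le_half hp))).trans ?_
  gcongr

theorem tendsto_tsum_negLogOneSubSubSelf :
    Tendsto (fun t : ℝ => ∑' p : Nat.Primes, negLogOneSubSubSelf (((p : ℕ) : ℝ) ^ (-(1 + t))))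
      (𝓝[>] 0) (𝓝 (∑' p : Nat.Primes, negLogOneSubSubSelf (((p : ℕ) : ℝ)⁻¹))) := by
  refine tendsto_tsum_of_dominated_convergence summable_primes_inv_sq (fun p => ?_) ?_
  · have hp0 : (0 : ℝ) < (p : ℕ) := by exact_mod_cast p.2.pos
    have hne : 1 - (p : ℝ) ^ (-(1 + (0 : ℝ))) ≠ 0 := by
      have h2 := prime_inv_le_half p.2
      rw [add_zero, Real.rpow_neg_one]
      linarith
    have hc : ContinuousAt
        (fun t : ℝ => negLogOneSubSubSelf (((p : ℕ) : ℝ) ^ (-(1 + t)))) 0 := by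
      unfold negLogOneSubSubSelf
      have h1 : ContinuousAt (fun t : ℝ => ((p : ℕ) : ℝ) ^ (-(1 + t))) 0 :=
        (Real.continuousAt_const_rpow hp0.ne').comp (by fun_prop)
      exact ((continuousAt_const.sub h1).log hne).neg.sub h1
    have := hc.tendsto.mono_left (nhdsWithin_le_nhds (s := Set.Ioi 0))
    simpa [Real.rpow_neg_one] using this
  · filter_upwards [self_mem_nhdsWithin] with t ht p
    exact norm_negLogOneSubSubSelf_prime_rpow_le (by linarith [Set.mem_Ioi.1 ht]) p.2

/-- The completely multiplicative function `n ↦ n ^ (-s)` for real `s ≠ 0`. -/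
noncomputable def rpowNegHom {s : ℝ} (hs : s ≠ 0) : ℕ →*₀ ℝ where
  toFun n := (n : ℝ) ^ (-s)
  map_zero' := by simp [Real.zero_rpow (neg_ne_zero.2 hs)]
  map_one' := by simp
  map_mul' m n := by
    rw [Nat.cast_mul, Real.mul_rpow (Nat.cast_nonneg m) (Nat.cast_nonneg n)]

theorem hasSum_neg_log_one_sub_prime_rpow {s : ℝ} (hs : 1 < s) :
    HasSum (fun p : Nat.Primes => -Real.log (1 - ((p : ℕ) : ℝ) ^ (-s)))
      (Real.log (∑' n : ℕ, 1 / (n : ℝ) ^ s)) := by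
  have hs0 : s ≠ 0 := by linarith
  have hval : ∀ n : ℕ, rpowNegHom hs0 n = (n : ℝ) ^ (-s) := fun n => rfl
  have hsum : Summable fun n : ℕ => (n : ℝ) ^ (-s) := Real.summable_nat_rpow.2 (by linarith)
  have h := EulerProduct.eulerProduct_completely_multiplicative_hasProd (f := rpowNegHom hs0) (by
    simp only [hval]; exact hsum.norm)
  have hZ : ∑' n : ℕ, rpowNegHom hs0 n = ∑' n : ℕ, 1 / (n : ℝ) ^ s :=
    tsum_congr fun n => by rw [hval, Real.rpow_neg (Nat.cast_nonneg n), one_div]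
  have hpos : 0 < ∑' n : ℕ, rpowNegHom hs0 n :=
    hsum.tsum_pos (fun n => by positivity) 1 (by simp)
  rw [hZ] at h hpos
  have hl := (Real.continuousAt_log hpos.ne').tendsto.comp h
  refine hl.congr fun F => ?_
  simp only [Function.comp, hval]
  rw [Real.log_prod]
  · exact Finset.sum_congr rfl fun p _ => Real.log_inv _
  · intro p _
    have h1 := prime_rpow_neg_le hs.le p.2
    have h2 := prime_inv_le_half p.2
    exact inv_ne_zero (by linarith)

/-- The Euler product splits `log ζ(1 + t)` into the prime sum and a remainder continuous up to `t =
0`, while `t ζ(1 + t) → 1`. -/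
theorem tendsto_tsum_prime_rpow_add_log :
    Tendsto (fun t : ℝ => ∑' p : Nat.Primes, ((p : ℕ) : ℝ) ^ (-(1 + t)) + Real.log t)
      (𝓝[>] 0) (𝓝 (-∑' p : Nat.Primes, negLogOneSubSubSelf (((p : ℕ) : ℝ)⁻¹))) := by
  have hshift : Tendsto (fun t : ℝ => 1 + t) (𝓝[>] 0) (𝓝[>] 1) := by
    refine tendsto_nhdsWithin_iff.2 ⟨?_, ?_⟩
    · have : Tendsto (fun t : ℝ => 1 + t) (𝓝 0) (𝓝 (1 + 0)) :=
        (continuous_const.add continuous_id).tendsto 0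
      rw [add_zero] at this
      exact this.mono_left nhdsWithin_le_nhds
    · filter_upwards [self_mem_nhdsWithin] with t ht
      simpa using ht
  have hz := ((Real.continuousAt_log one_ne_zero).tendsto.comp
    tendsto_sub_mul_tsum_nat_rpow).comp hshift
  rw [Real.log_one] at hz
  have h := hz.sub tendsto_tsum_negLogOneSubSubSelf
  rw [zero_sub] at h
  refine h.congr' ?_
  filter_upwards [self_mem_nhdsWithin] with t ht
  have ht0 : 0 < t := ht
  have hE := hasSum_neg_log_one_sub_prime_rpow (s := 1 + t) (by linarith)
  have hP : Summable fun p : Nat.Primes => ((p : ℕ) : ℝ) ^ (-(1 + t)) :=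
    Nat.Primes.summable_rpow.2 (by linarith)
  have hd := (hE.sub hP.hasSum).tsum_eq
  have hZ : ∑' n : ℕ, 1 / (n : ℝ) ^ (1 + t) ≠ 0 := by
    have hs : Summable fun n : ℕ => 1 / (n : ℝ) ^ (1 + t) :=
      Real.summable_one_div_nat_rpow.2 (by linarith)
    exact (hs.tsum_pos (fun n => by positivity) 1 (by simp)).ne'
  simp only [Function.comp, add_sub_cancel_left, negLogOneSubSubSelf]
  rw [hd, Real.log_mul ht0.ne' hZ]
  ring

/-- The quotient `(1 - 2^(-t)) / t` tends to the derivative `log 2`. -/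
theorem tendsto_log_one_sub_two_rpow_sub_log :
    Tendsto (fun t : ℝ => Real.log (1 - 2 ^ (-t)) - Real.log t) (𝓝[>] 0)
      (𝓝 (Real.log (Real.log 2))) := by
  have hl : 0 < Real.log 2 := Real.log_pos one_lt_two
  have hd : HasDerivAt (fun t : ℝ => 1 - (2 : ℝ) ^ (-t)) (Real.log 2) 0 := by
    have h := ((hasDerivAt_neg (0 : ℝ)).const_rpow (a := 2) two_pos).const_sub 1
    simpa using h
  have h2 := hd.tendsto_slope_zero_right
  have h3 := (Real.continuousAt_log hl.ne').tendsto.comp h2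
  refine h3.congr' ?_
  filter_upwards [self_mem_nhdsWithin] with t ht
  have ht0 : 0 < t := ht
  have h4 : 1 - (2 : ℝ) ^ (-t) ≠ 0 := by
    have := Real.rpow_lt_one_of_one_lt_of_neg one_lt_two (neg_lt_zero.2 ht0)
    linarith
  simp only [Function.comp, zero_add, neg_zero, Real.rpow_zero, sub_self, sub_zero, smul_eq_mul]
  rw [Real.log_mul (inv_ne_zero ht0.ne') h4, Real.log_inv]
  ring

/-- Convergence being known, Abel summation with weights `(m + 1)^(-t)` identifies the limit as `t →
0+`; the two `log t` singularities cancel. -/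
theorem tendsto_sum_primeCompensated :
    Tendsto (fun n => ∑ m ∈ Finset.range n, primeCompensated m) atTop
      (𝓝 (Real.log (Real.log 2) -
        ∑' p : Nat.Primes, negLogOneSubSubSelf (((p : ℕ) : ℝ)⁻¹))) := by
  obtain ⟨c, hc⟩ := exists_tendsto_sum_primeCompensated
  have habel : Tendsto (fun t : ℝ => ∑' m : ℕ, ((m + 1 : ℕ) : ℝ) ^ (-t) * primeCompensated m)
      (𝓝[>] 0) (𝓝 c) := by
    refine tendsto_tsum_mul_of_tendsto_sum hc ?_ ?_ ?_ (fun m => ?_) ?_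
    · filter_upwards [self_mem_nhdsWithin] with t ht a b hab
      have ht0 : 0 < t := ht
      exact Real.rpow_le_rpow_of_nonpos (by positivity)
        (by exact_mod_cast Nat.succ_le_succ hab) (by linarith)
    · filter_upwards [self_mem_nhdsWithin] with t ht
      exact (tendsto_rpow_neg_atTop ht).comp
        (tendsto_natCast_atTop_atTop.comp (tendsto_add_atTop_nat 1))
    · exact Eventually.of_forall fun t => by simp
    · have hm : ((m + 1 : ℕ) : ℝ) ≠ 0 := by positivity
      have h1 : ContinuousAt (fun t : ℝ => ((m + 1 : ℕ) : ℝ) ^ (-t)) 0 :=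
        (Real.continuousAt_const_rpow hm).comp continuousAt_neg
      have := h1.tendsto.mono_left (nhdsWithin_le_nhds (s := Set.Ioi 0))
      rwa [neg_zero, Real.rpow_zero] at this
    · filter_upwards [self_mem_nhdsWithin] with t ht
      exact (hasSum_rpow_mul_primeCompensated ht).summable
  have hval := tendsto_tsum_prime_rpow_add_log.add tendsto_log_one_sub_two_rpow_sub_log
  have : c = -(∑' p : Nat.Primes, negLogOneSubSubSelf (((p : ℕ) : ℝ)⁻¹)) +
      Real.log (Real.log 2) := by
    refine tendsto_nhds_unique habel (hval.congr' ?_)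
    filter_upwards [self_mem_nhdsWithin] with t ht
    rw [(hasSum_rpow_mul_primeCompensated ht).tsum_eq]
    ring
  rwa [this, neg_add_eq_sub] at hc

theorem tendsto_log_natLog_two_sub_log_log :
    Tendsto (fun n : ℕ => Real.log (Nat.log 2 n : ℝ) - Real.log (Real.log n)) atTop
      (𝓝 (-Real.log (Real.log 2))) := by
  have hl : 0 < Real.log 2 := Real.log_pos one_lt_two
  have hlogn : Tendsto (fun n : ℕ => Real.log (n : ℝ)) atTop atTop :=
    Real.tendsto_log_atTop.comp tendsto_natCast_atTop_atTop
  have hratio : Tendsto (fun n : ℕ => (Nat.log 2 n : ℝ) / Real.log n) atTop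
      (𝓝 (Real.log 2)⁻¹) := by
    have hlow : Tendsto (fun n : ℕ => (Real.log 2)⁻¹ - (Real.log (n : ℝ))⁻¹) atTop
        (𝓝 (Real.log 2)⁻¹) := by
      simpa using (tendsto_inv_atTop_zero.comp hlogn).const_sub (Real.log 2)⁻¹
    refine tendsto_of_tendsto_of_tendsto_of_le_of_le' hlow tendsto_const_nhds ?_ ?_
    · filter_upwards [eventually_gt_atTop 1] with n hn
      have h0 : 0 < Real.log n := Real.log_pos (by exact_mod_cast hn)
      have h := log_le_add_one_mul_log_two (n := n) (by omega)
      rw [← mul_le_mul_iff_of_pos_right (mul_pos h0 hl)]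
      field_simp
      linarith
    · filter_upwards [eventually_gt_atTop 1] with n hn
      have h0 : 0 < Real.log n := Real.log_pos (by exact_mod_cast hn)
      have h := mul_log_two_le_log (n := n) (by omega)
      rw [← mul_le_mul_iff_of_pos_right (mul_pos h0 hl)]
      field_simp
      linarith
  have h := (Real.continuousAt_log (inv_ne_zero hl.ne')).tendsto.comp hratio
  rw [Real.log_inv] at h
  refine h.congr' ?_
  filter_upwards [eventually_gt_atTop 1] with n hn
  have h0 : 0 < Real.log n := Real.log_pos (by exact_mod_cast hn)
  have h1 : 0 < Nat.log 2 n := Nat.log_pos one_lt_two hn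
  exact Real.log_div (by exact_mod_cast h1.ne') h0.ne'

theorem tendsto_sum_primesLE {f : ℕ → ℝ} (hf : Summable fun p : Nat.Primes => f p) :
    Tendsto (fun n : ℕ => ∑ p ∈ n.primesLE, f p) atTop (𝓝 (∑' p : Nat.Primes, f p)) := by
  have h : HasSum ({p : ℕ | p.Prime}.indicator f) (∑' p : Nat.Primes, f p) :=
    hasSum_subtype_iff_indicator.1 hf.hasSum
  have h2 := h.tendsto_sum_nat.comp (tendsto_add_atTop_nat 1)
  refine h2.congr fun n => ?_
  simp only [Function.comp]
  rw [Nat.primesLE_eq_filter_range, Finset.sum_filter]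
  exact Finset.sum_congr rfl fun p _ => by simp [Set.indicator_apply]

/-- The remainder series and `log (log 2)` each appear twice with opposite signs, leaving only the
`γ` of the harmonic sum. -/
theorem tendsto_sum_neg_log_one_sub_inv_prime_sub_log_log :
    Tendsto (fun n : ℕ => ∑ p ∈ n.primesLE, -Real.log (1 - (p : ℝ)⁻¹) - Real.log (Real.log n))
      atTop (𝓝 Real.eulerMascheroniConstant) := by
  have hE : Summable fun p : Nat.Primes => negLogOneSubSubSelf (((p : ℕ) : ℝ)⁻¹) :=
    Summable.of_norm_bounded summable_primes_inv_sq fun p => by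
      simpa [Real.rpow_neg_one] using norm_negLogOneSubSubSelf_prime_rpow_le le_rfl p.2
  have hH : Tendsto (fun n : ℕ => (harmonic (Nat.log 2 n) : ℝ) - Real.log (Nat.log 2 n : ℝ))
      atTop (𝓝 Real.eulerMascheroniConstant) := by
    refine Real.tendsto_harmonic_sub_log.comp (tendsto_atTop.2 fun b => ?_)
    filter_upwards [eventually_ge_atTop (2 ^ b)] with n hn
    exact Nat.le_log_of_pow_le one_lt_two hn
  have h := ((tendsto_sum_primeCompensated.add
    (tendsto_sum_primesLE (f := fun p => negLogOneSubSubSelf (p : ℝ)⁻¹) hE)).add hH).add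
    tendsto_log_natLog_two_sub_log_log
  convert h using 2 with n
  · rw [sum_primeCompensated]
    simp only [negLogOneSubSubSelf, Finset.sum_sub_distrib, one_div]
    ring
  · ring

theorem tendsto_prod_inv_one_sub_inv_prime_div_log :
    Tendsto (fun n : ℕ => (∏ p ∈ n.primesLE, (1 - (p : ℝ)⁻¹)⁻¹) / Real.log n) atTop
      (𝓝 (Real.exp Real.eulerMascheroniConstant)) := by
  have h := (Real.continuous_exp.tendsto _).comp tendsto_sum_neg_log_one_sub_inv_prime_sub_log_log
  refine h.congr' ?_
  filter_upwards [eventually_gt_atTop 1] with n hn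
  have h0 : 0 < Real.log n := Real.log_pos (by exact_mod_cast hn)
  rw [Function.comp, Real.exp_sub, Real.exp_log h0, Real.exp_sum]
  congr 1
  refine Finset.prod_congr rfl fun p hp => ?_
  have := prime_inv_le_half (Nat.prime_of_mem_primesLE hp)
  rw [Real.exp_neg, Real.exp_log (by linarith)]

/-- Write `1 + 1/p = (1 - 1/p²) / (1 - 1/p)` and use the Euler product of `ζ(2)`. -/
theorem tendsto_prod_one_add_inv_prime_div_log :
    Tendsto (fun n : ℕ => (∏ p ∈ n.primesLE, (1 + 1 / (p : ℝ))) / Real.log n) atTop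
      (𝓝 (6 / Real.pi ^ 2 * Real.exp Real.eulerMascheroniConstant)) := by
  have hval : ∀ n : ℕ, rpowNegHom (two_ne_zero (α := ℝ)) n = (n : ℝ) ^ (-2 : ℝ) := fun n => rfl
  have hsum : Summable fun n : ℕ => (n : ℝ) ^ (-2 : ℝ) := Real.summable_nat_rpow.2 (by norm_num)
  have hz : Tendsto (fun n : ℕ => ∏ p ∈ n.primesLE, (1 - (p : ℝ) ^ (-2 : ℝ))⁻¹) atTop
      (𝓝 (Real.pi ^ 2 / 6)) := by
    have h := EulerProduct.eulerProduct_completely_multiplicative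
      (f := rpowNegHom (two_ne_zero (α := ℝ))) (by simp only [hval]; exact hsum.norm)
    have hZ : ∑' n : ℕ, rpowNegHom (two_ne_zero (α := ℝ)) n = Real.pi ^ 2 / 6 := by
      rw [← hasSum_zeta_two.tsum_eq]
      exact tsum_congr fun n => by
        rw [hval, Real.rpow_neg (Nat.cast_nonneg n), one_div]; norm_cast
    rw [hZ] at h
    exact h.comp (tendsto_add_atTop_nat 1)
  have h := (hz.inv₀ (by positivity)).mul tendsto_prod_inv_one_sub_inv_prime_div_log
  rw [inv_div] at h
  refine h.congr fun n => ?_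
  rw [← Finset.prod_inv_distrib, ← mul_div_assoc, ← Finset.prod_mul_distrib]
  congr 1
  refine Finset.prod_congr rfl fun p hp => ?_
  have hp := Nat.prime_of_mem_primesLE hp
  have h1 := prime_inv_le_half hp
  have h2 : 1 - (p : ℝ)⁻¹ ≠ 0 := by linarith
  have h3 : (p : ℝ) ^ (-2 : ℝ) = ((p : ℝ)⁻¹) ^ 2 := by
    rw [Real.rpow_neg (Nat.cast_nonneg p), inv_pow]; norm_cast
  rw [inv_inv, h3, one_div, ← div_eq_mul_inv, div_eq_iff h2]
  ring

/-! ### The limit superior -/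

/-- The prime divisors exceeding `y = log n` have product at most `n`, so there are at most `y / log
y` of them, each contributing at most `exp (1 / y)`. -/
theorem prod_primeFactors_one_add_inv_le {n : ℕ} (hn : 1 < Real.log n) :
    ∏ p ∈ n.primeFactors, (1 + 1 / (p : ℝ)) ≤
      (∏ p ∈ (⌊Real.log n⌋₊).primesLE, (1 + 1 / (p : ℝ))) *
        Real.exp (Real.log (Real.log n))⁻¹ := by
  set y := Real.log n with hy
  have hy0 : 0 < y := by linarith
  have hly : 0 < Real.log y := Real.log_pos hn
  have hn0 : n ≠ 0 := by rintro rfl; norm_num at hy; linarith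
  rw [← Finset.prod_filter_mul_prod_filter_not n.primeFactors (fun p => p ≤ ⌊y⌋₊)]
  refine mul_le_mul ?_ ?_ (Finset.prod_nonneg fun _ _ => by positivity)
    (Finset.prod_nonneg fun _ _ => by positivity)
  · have hsub : n.primeFactors.filter (fun p => p ≤ ⌊y⌋₊) ⊆ (⌊y⌋₊).primesLE := fun p hp => by
      rw [Finset.mem_filter] at hp
      exact Nat.mem_primesLE.2 ⟨hp.2, Nat.prime_of_mem_primeFactors hp.1⟩
    exact Finset.prod_le_prod_of_subset_of_one_le hsub (fun _ _ => by positivity)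
      fun p _ _ => by simp
  · set S := n.primeFactors.filter (fun p => ¬ p ≤ ⌊y⌋₊) with hS
    have hlarge : ∀ p ∈ S, y ≤ p := fun p hp =>
      ((Nat.floor_lt hy0.le).1 (not_le.1 (Finset.mem_filter.1 hp).2)).le
    have hcard : S.card * Real.log y ≤ y := by
      have hdvd : ∏ p ∈ S, p ∣ n :=
        (Finset.prod_dvd_prod_of_subset _ _ _ (Finset.filter_subset _ _)).trans
          (Nat.prod_primeFactors_dvd n)
      have hle : y ^ S.card ≤ n := by
        calc y ^ S.card = ∏ _p ∈ S, y := by simp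
          _ ≤ ∏ p ∈ S, (p : ℝ) := Finset.prod_le_prod (fun _ _ => hy0.le) hlarge
          _ ≤ n := by
            rw [← Nat.cast_prod]
            exact_mod_cast Nat.le_of_dvd (Nat.pos_of_ne_zero hn0) hdvd
      have := Real.log_le_log (by positivity) hle
      rwa [Real.log_pow] at this
    calc ∏ p ∈ S, (1 + 1 / (p : ℝ)) ≤ ∏ _p ∈ S, Real.exp y⁻¹ := by
          refine Finset.prod_le_prod (fun _ _ => by positivity) fun p hp => ?_
          have h1 : 1 / (p : ℝ) ≤ y⁻¹ := by
            rw [one_div]; exact inv_anti₀ hy0 (hlarge p hp)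
          linarith [Real.add_one_le_exp y⁻¹]
      _ = Real.exp (S.card * y⁻¹) := by rw [Finset.prod_const, ← Real.exp_nat_mul]
      _ ≤ _ := by
          refine Real.exp_le_exp.2 ?_
          rw [← div_eq_mul_inv, div_le_iff₀ hy0, ← div_eq_inv_mul, le_div_iff₀ hly]
          exact hcard

theorem limsup_sigmaExpUnitary_le :
    limsup (fun n : ℕ =>
        (((sigmaExpUnitary n : ℝ) / ((n : ℝ) * Real.log (Real.log (n : ℝ))) : ℝ) : EReal))
      atTop ≤ ((6 / Real.pi ^ 2 * Real.exp Real.eulerMascheroniConstant : ℝ) : EReal) := by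
  have hlog : Tendsto (fun n : ℕ => Real.log (n : ℝ)) atTop atTop :=
    Real.tendsto_log_atTop.comp tendsto_natCast_atTop_atTop
  have hfloor : Tendsto (fun n : ℕ => ⌊Real.log (n : ℝ)⌋₊) atTop atTop :=
    tendsto_nat_floor_atTop.comp hlog
  have hexp : Tendsto (fun n : ℕ => Real.exp (Real.log (Real.log (n : ℝ)))⁻¹) atTop (𝓝 1) := by
    have := (Real.continuous_exp.tendsto 0).comp
      (tendsto_inv_atTop_zero.comp (Real.tendsto_log_atTop.comp hlog))
    rwa [Real.exp_zero] at this
  have hg := (tendsto_prod_one_add_inv_prime_div_log.comp hfloor).mul hexp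
  rw [mul_one] at hg
  refine (limsup_le_limsup ?_).trans_eq ((continuous_coe_real_ereal.tendsto _).comp hg).limsup_eq
  filter_upwards [eventually_ne_atTop 0, hlog.eventually_gt_atTop 2] with n hn h2
  have hn0 : (0 : ℝ) < n := by exact_mod_cast Nat.pos_of_ne_zero hn
  have hll : 0 < Real.log (Real.log n) := Real.log_pos (by linarith)
  have hf2 : 2 ≤ ⌊Real.log (n : ℝ)⌋₊ := Nat.le_floor (by exact_mod_cast h2.le)
  have hf1 : (1 : ℝ) < ⌊Real.log (n : ℝ)⌋₊ := by exact_mod_cast hf2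
  have hlf : 0 < Real.log (⌊Real.log (n : ℝ)⌋₊ : ℝ) := Real.log_pos hf1
  have hle : Real.log (⌊Real.log (n : ℝ)⌋₊ : ℝ) ≤ Real.log (Real.log n) :=
    Real.log_le_log (by linarith) (Nat.floor_le (by linarith))
  refine EReal.coe_le_coe_iff.2 ?_
  have h3 := (sigmaExpUnitary_le hn).trans (mul_le_mul_of_nonneg_left
    (prod_primeFactors_one_add_inv_le (n := n) (by linarith)) hn0.le)
  have hP : 0 ≤ ∏ p ∈ (⌊Real.log (n : ℝ)⌋₊).primesLE, (1 + 1 / (p : ℝ)) :=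
    Finset.prod_nonneg fun _ _ => by positivity
  calc (sigmaExpUnitary n : ℝ) / (n * Real.log (Real.log n))
      ≤ (n * ((∏ p ∈ (⌊Real.log n⌋₊).primesLE, (1 + 1 / (p : ℝ))) *
          Real.exp (Real.log (Real.log n))⁻¹)) / (n * Real.log (Real.log n)) := by gcongr
    _ = (∏ p ∈ (⌊Real.log n⌋₊).primesLE, (1 + 1 / (p : ℝ))) / Real.log (Real.log n) *
          Real.exp (Real.log (Real.log n))⁻¹ := by field_simp
    -- Taking the floor only shrinks the denominator, and gives the exact form of Mertens' product.
    _ ≤ (∏ p ∈ (⌊Real.log n⌋₊).primesLE, (1 + 1 / (p : ℝ))) / Real.log (⌊Real.log n⌋₊ : ℝ) *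
          Real.exp (Real.log (Real.log n))⁻¹ := by gcongr

theorem le_primorial_of_prime_le {p x : ℕ} (hp : p.Prime) (hpx : p ≤ x) : p ≤ primorial x :=
  Nat.le_of_dvd (primorial_pos x) (by
    rw [primorial_eq_prod_primesLE]
    exact Finset.dvd_prod_of_mem _ (Nat.mem_primesLE.2 ⟨hpx, hp⟩))

theorem tendsto_primorial_sq_atTop : Tendsto (fun x : ℕ => primorial x ^ 2) atTop atTop := by
  refine tendsto_atTop.2 fun b => ?_
  obtain ⟨p, hbp, hp⟩ := Nat.exists_infinite_primes b
  filter_upwards [eventually_ge_atTop p] with x hx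
  exact hbp.trans ((le_primorial_of_prime_le hp hx).trans (Nat.le_self_pow two_ne_zero _))

theorem le_limsup_sigmaExpUnitary :
    ((6 / Real.pi ^ 2 * Real.exp Real.eulerMascheroniConstant : ℝ) : EReal) ≤
      limsup (fun n : ℕ =>
        (((sigmaExpUnitary n : ℝ) / ((n : ℝ) * Real.log (Real.log (n : ℝ))) : ℝ) : EReal))
      atTop := by
  -- From `primorial x ≤ 4 ^ x`: `log (primorial x ^ 2) ≤ 2 x log 4`, whose logarithm is `A + log
  -- x`.
  set A : ℝ := Real.log (2 * Real.log 4) with hA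
  have hl4 : 0 < Real.log 4 := Real.log_pos (by norm_num)
  have hlog : Tendsto (fun x : ℕ => Real.log (x : ℝ)) atTop atTop :=
    Real.tendsto_log_atTop.comp tendsto_natCast_atTop_atTop
  have hratio : Tendsto (fun x : ℕ => Real.log (x : ℝ) / (A + Real.log x)) atTop (𝓝 1) := by
    have h : Tendsto (fun x : ℕ => (A / Real.log (x : ℝ) + 1)⁻¹) atTop (𝓝 (0 + 1)⁻¹) :=
      ((hlog.const_div_atTop A).add_const 1).inv₀ (by norm_num)
    rw [zero_add, inv_one] at h
    refine h.congr' ?_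
    filter_upwards [hlog.eventually_gt_atTop 0] with x hx
    rw [div_add_one hx.ne', inv_div]
  have hh := tendsto_prod_one_add_inv_prime_div_log.mul hratio
  rw [mul_one] at hh
  have hlogφ : Tendsto (fun x : ℕ => Real.log ((primorial x ^ 2 : ℕ) : ℝ)) atTop atTop :=
    hlog.comp tendsto_primorial_sq_atTop
  -- The upper limit along the squared primorials is at most the full one.
  refine (((continuous_coe_real_ereal.tendsto _).comp hh).limsup_eq.symm.trans_le
    (limsup_le_limsup ?_)).trans (limsup_le_limsup_of_le (f := map (fun x => primorial x ^ 2) atTop)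
      tendsto_primorial_sq_atTop)
  filter_upwards [hlog.eventually_gt_atTop 0, hlogφ.eventually_gt_atTop 1,
    eventually_gt_atTop 0] with x hx hφ hx0
  have hx0' : (0 : ℝ) < x := by exact_mod_cast hx0
  have hll : 0 < Real.log (Real.log ((primorial x ^ 2 : ℕ) : ℝ)) := Real.log_pos hφ
  have hq0 : (0 : ℝ) < primorial x := by exact_mod_cast primorial_pos x
  have hle : Real.log (Real.log ((primorial x ^ 2 : ℕ) : ℝ)) ≤ A + Real.log x := by
    rw [hA, ← Real.log_mul (by positivity) hx0'.ne']
    refine Real.log_le_log (by linarith) ?_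
    have h1 : Real.log (primorial x : ℝ) ≤ x * Real.log 4 := by
      rw [← Real.log_pow]
      exact Real.log_le_log hq0 (by exact_mod_cast primorial_le_four_pow x)
    rw [Nat.cast_pow, Real.log_pow]
    push_cast
    linarith
  refine EReal.coe_le_coe_iff.2 ?_
  have hs := le_sigmaExpUnitary_sq_of_squarefree (squarefree_primorial x)
  rw [primeFactors_primorial] at hs
  have hP : 0 ≤ ∏ p ∈ x.primesLE, (1 + 1 / (p : ℝ)) := Finset.prod_nonneg fun _ _ => by positivity
  calc (∏ p ∈ x.primesLE, (1 + 1 / (p : ℝ))) / Real.log x * (Real.log x / (A + Real.log x))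
      = (∏ p ∈ x.primesLE, (1 + 1 / (p : ℝ))) / (A + Real.log x) := by field_simp
    _ ≤ (∏ p ∈ x.primesLE, (1 + 1 / (p : ℝ))) /
          Real.log (Real.log ((primorial x ^ 2 : ℕ) : ℝ)) := by gcongr
    _ = ((primorial x : ℝ) ^ 2 * ∏ p ∈ x.primesLE, (1 + 1 / (p : ℝ))) /
          (((primorial x ^ 2 : ℕ) : ℝ) * Real.log (Real.log ((primorial x ^ 2 : ℕ) : ℝ))) := by
        rw [Nat.cast_pow, mul_div_mul_left _ _ (by positivity)]
    _ ≤ _ := by gcongr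

/-- The limit superior is taken in the extended reals, so no boundedness is presupposed. -/
theorem theorem1 :
    Filter.limsup
      (fun n : ℕ =>
        (((sigmaExpUnitary n : ℝ) / ((n : ℝ) * Real.log (Real.log (n : ℝ))) : ℝ) : EReal))
      Filter.atTop =
    ((6 / Real.pi ^ 2 * Real.exp Real.eulerMascheroniConstant : ℝ) : EReal) :=
  le_antisymm limsup_sigmaExpUnitary_le le_limsup_sigmaExpUnitary
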